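/- Let $R$ be a $3$-dimensional regular local ring with maximal ideal $\mathfrak m = (x,y,z)R$, and let $I$ be the ideal of $R$ generated by the maximal minors of the matrix $$\begin{pmatrix} x & y & z \\ y & z & x^2 \end{pmatrix}.$$ For $n \ge 1$ let $I^{(n)} = \bigcap_{\mathfrak p} (I^nR_{\mathfrak p} \cap R)$ denote the $n$-th symbolic power of $I$, where $\mathfrak p$ runs over the minimal primes of $I$, and let $\ell_R$ denote length. Then for every $n \ge 1$, with $q = \lfloor n/2 \rfloor$, $$\ell_R\bigl(I^{(n)}/I^n\bigr) = \sum_{k=1}^{q} \binom{n-2k+2}{2}.$$ In closed form, $$\ell_R\bigl(I^{(n)}/I^n\bigr) = \begin{cases} \dfrac12\dbinom{n+2}{3} - \dfrac14\dbinom{n+1}{2} - \dfrac18 n & \text{if } n \text{ is even},\\[2ex] \dfrac12\dbinom{n+2}{3} - \dfrac14\dbinom{n+1}{2} - \dfrac18 n - \dfrac18 & \text{if } n \text{ is odd}. \end{cases}$$ As a consequence, the $\epsilon$-multiplicity $\epsilon(I) := \lim_{n\to\infty} \dfrac{3!}{n^3}\,\ell_R\bigl(I^{(n)}/I^n\bigr)$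 of $I$ exists and equals $\dfrac12$. -/

import Mathlib

open Filter Topology

/-- The ideal generated by the maximal minors of a `2 × 3` matrix, i.e. by the determinants of
the `2 × 2` submatrices obtained by choosing two columns, in increasing order. -/
def maximalMinorsIdeal {R : Type*} [CommRing R] (M : Matrix (Fin 2) (Fin 3) R) : Ideal R :=
  Ideal.span (Set.range fun e : Fin 2 ↪o Fin 3 => (M.submatrix id e).det)

/-- The `n`-th symbolic power `I⁽ⁿ⁾ = ⋂_{𝔭 ∈ Min(R/I)} (Iⁿ R_𝔭 ∩ R)`, where `𝔭` runs over the
minimal primes of `I` and `J ∩ R` is the preimage of `J` under `R → R_𝔭`. -/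
def symbolicPower {R : Type*} [CommRing R] (I : Ideal R) (n : ℕ) : Ideal R :=
  ⨅ p : {p : PrimeSpectrum R // p.asIdeal ∈ I.minimalPrimes},
    ((I ^ n).map (algebraMap R (Localization.AtPrime p.1.asIdeal))).comap
      (algebraMap R (Localization.AtPrime p.1.asIdeal))

/-- `Iⁿ ⊆ I⁽ⁿ⁾`, so that the quotient `I⁽ⁿ⁾ / Iⁿ` makes sense. -/
theorem pow_le_symbolicPower {R : Type*} [CommRing R] (I : Ideal R) (n : ℕ) :
    I ^ n ≤ symbolicPower I n :=
  le_iInf fun _ => Ideal.le_comap_map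

/-- The length `ℓ_R(I⁽ⁿ⁾ / Iⁿ)`, with value `⊤` if the module does not have finite length. -/
noncomputable def symbolicQuotientLength {R : Type*} [CommRing R] (I : Ideal R) (n : ℕ) : ℕ∞ :=
  Module.length R (↥(symbolicPower I n) ⧸ (I ^ n).submoduleOf (symbolicPower I n))

/-- For an ideal `I` of a three-dimensional local ring: the lengths `ℓ_R(I⁽ⁿ⁾ / Iⁿ)`, `n ≥ 1`,
are finite, and the limit `lim_{n → ∞} (3! / n³) · ℓ_R(I⁽ⁿ⁾ / Iⁿ)` defining the
`ε`-multiplicity of `I` exists and equals `e`. -/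
def HasEpsilonMultiplicity {R : Type*} [CommRing R] (I : Ideal R) (e : ℝ) : Prop :=
  (∀ n : ℕ, 1 ≤ n → symbolicQuotientLength I n ≠ ⊤) ∧
    Tendsto (fun n : ℕ =>
      ((Nat.factorial 3 : ℕ) : ℝ) / (n : ℝ) ^ 3 * ((symbolicQuotientLength I n).toNat : ℝ))
      atTop (𝓝 e)

/-! Let `v` be arbitrary (`v = x` in the theorem), let `I` be the ideal of minors of
`(x, y, z; y, z, v x)` and `d = v² x³ - 3 v x y z + z³ + v y³`. Each of `x d`, `y d`, `z d` is a
quadratic form in the minors, so `𝔪 d ⊆ I²`. Put `Jₙ = ∑ₖ dᵏ Iⁿ⁻²ᵏ`.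

* With `a = x z - y²` one has `I² ⊆ a I + (d)`, while `x, a, d` is a regular sequence and `x` is
  regular modulo `I`. Hence `x` is regular modulo every `Jₙ`; as a power of `x` multiplies `Jₙ` into
  `Iⁿ`, and `√(I + (x)) = 𝔪`, this gives `I⁽ⁿ⁾ = Jₙ`.
* Multiplication by `d` maps `Jₙ` onto `Jₙ₊₂ / Iⁿ⁺²`. The minors and `d` have orders `2` and `3`,
  and their leading forms satisfy `P(minors) ≠ 0` for every form `P ≠ 0` over the residue field,
  because the minors define a Cremona transformation. Comparing orders, `d r ∈ Iⁿ⁺²` with `r ∈ Jₙ`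
  forces `r ∈ 𝔪 Iⁿ`, so the kernel is `𝔪 Iⁿ`.
* Consequently `ℓ(Jₙ₊₂ / Iⁿ⁺²) = ℓ(Iⁿ / 𝔪 Iⁿ) + ℓ(Jₙ / Iⁿ)`, and `Iⁿ / 𝔪 Iⁿ` has as basis the
  monomials of degree `n` in the three minors.
-/

section RegularParameters

variable {R : Type*} [CommRing R]

/-- A family of elements is permutably regular if each member is a nonzerodivisor modulo any
set of other members; for a finite family: if it is a (weakly) regular sequence in every order. -/
def IsPermutablyRegular {σ : Type*} (s : σ → R) : Prop :=
  ∀ T : Set σ, ∀ i ∉ T, IsSMulRegular (R ⧸ Ideal.span (s '' T)) (s i)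

theorem ringKrullDim_quotient_le_quotient_sup_span_add_card [IsNoetherianRing R] (𝔞 : Ideal R)
    {t : Finset R} (ht : (t : Set R) ⊆ Ring.jacobson R) :
    ringKrullDim (R ⧸ 𝔞) ≤ ringKrullDim (R ⧸ 𝔞 ⊔ Ideal.span t) + t.card := by
  classical
  have ht' : ((t.image (Ideal.Quotient.mk 𝔞) : Finset (R ⧸ 𝔞)) : Set (R ⧸ 𝔞)) ⊆
      Ring.jacobson (R ⧸ 𝔞) := by
    rw [Finset.coe_image, Set.image_subset_iff]
    exact fun r hr => Ring.map_jacobson_le (Ideal.Quotient.mk 𝔞) (Submodule.mem_map_of_mem (ht hr))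
  have h := ringKrullDim_le_ringKrullDim_quotient_add_card _ ht'
  rw [Finset.coe_image, ← Ideal.map_span,
    ringKrullDim_eq_of_ringEquiv (DoubleQuot.quotQuotEquivQuotSup _ _)] at h
  exact h.trans (by gcongr; exact Finset.card_image_le)

theorem ringKrullDim_quotient_add_one_le_of_lt {P J : Ideal R} [P.IsPrime] (h : P < J) :
    ringKrullDim (R ⧸ J) + 1 ≤ ringKrullDim (R ⧸ P) := by
  obtain ⟨r, hrJ, hrP⟩ := SetLike.exists_of_lt h
  refine ringKrullDim_succ_le_of_surjective (Ideal.Quotient.factor h.le)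
    (Ideal.Quotient.factor_surjective h.le) (r := Ideal.Quotient.mk P r)
    (mem_nonZeroDivisors_of_ne_zero (by rwa [Ne, Ideal.Quotient.eq_zero_iff_mem])) ?_
  rwa [Ideal.Quotient.factor_mk, Ideal.Quotient.eq_zero_iff_mem]

theorem exists_isPrime_le_ringKrullDim_quotient {𝔞 : Ideal R} {n : ℕ}
    (h : (n : WithBot ℕ∞) ≤ ringKrullDim (R ⧸ 𝔞)) :
    ∃ q : Ideal R, q.IsPrime ∧ 𝔞 ≤ q ∧ (n : WithBot ℕ∞) ≤ ringKrullDim (R ⧸ q) := by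
  rw [ringKrullDim_quotient, Order.le_krullDim_iff] at h
  obtain ⟨l, hl⟩ := h
  refine ⟨l.head.1.asIdeal, l.head.1.isPrime, l.head.2, ?_⟩
  rw [ringKrullDim_quotient, Order.le_krullDim_iff]
  exact ⟨⟨l.length, fun i => ⟨(l i).1, l.head_le i⟩, fun i => l.step i⟩, hl⟩

variable [IsLocalRing R] [IsNoetherianRing R]

theorem isPrime_of_isPrime_sup_span {𝔞 : Ideal R} {r : R} {n : ℕ}
    (hr : r ∈ IsLocalRing.maximalIdeal R) (hP : (𝔞 ⊔ Ideal.span {r}).IsPrime)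
    (hn : ringKrullDim (R ⧸ 𝔞 ⊔ Ideal.span {r}) = n)
    (hn' : ((n + 1 : ℕ) : WithBot ℕ∞) ≤ ringKrullDim (R ⧸ 𝔞)) : 𝔞.IsPrime := by
  obtain ⟨q, hq, h𝔞q, hdim⟩ := exists_isPrime_le_ringKrullDim_quotient hn'
  have hle : 𝔞 ⊔ Ideal.span {r} ≤ q ⊔ Ideal.span {r} := sup_le_sup_right h𝔞q _
  have hdim' : ((n + 1 : ℕ) : WithBot ℕ∞) ≤ ringKrullDim (R ⧸ q ⊔ Ideal.span {r}) + 1 := by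
    have h := ringKrullDim_quotient_le_quotient_sup_span_add_card q (t := {r})
      (by simpa [IsLocalRing.ringJacobson_eq_maximalIdeal] using hr)
    rw [Finset.coe_singleton, Finset.card_singleton, Nat.cast_one] at h
    exact hdim.trans h
  have hrq : r ∉ q := fun hrq => by
    rw [sup_eq_left.mpr ((Ideal.span_singleton_le_iff_mem q).mpr hrq)] at hle
    have h : ((n + 1 : ℕ) : WithBot ℕ∞) ≤ n := hdim.trans ((ringKrullDim_le_of_surjective
      (Ideal.Quotient.factor hle) (Ideal.Quotient.factor_surjective hle)).trans hn.le)
    norm_cast at h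
    omega
  have heq : 𝔞 ⊔ Ideal.span {r} = q ⊔ Ideal.span {r} := hle.eq_of_not_lt fun hlt => by
    have h : ((n + 1 : ℕ) : WithBot ℕ∞) ≤ n :=
      hdim'.trans ((ringKrullDim_quotient_add_one_le_of_lt hlt).trans hn.le)
    norm_cast at h
    omega
  have hle : q ≤ 𝔞 := by
    refine Submodule.le_of_le_smul_of_le_jacobson_bot (I := IsLocalRing.maximalIdeal R)
      (IsNoetherian.noetherian q) (IsLocalRing.jacobson_eq_maximalIdeal ⊥ bot_ne_top).ge ?_
    intro w hw
    obtain ⟨u, hu, v, hv, rfl⟩ := Submodule.mem_sup.mp (heq.ge (Ideal.mem_sup_left hw))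
    obtain ⟨t, rfl⟩ := Ideal.mem_span_singleton'.mp hv
    have ht : t ∈ q :=
      (hq.mem_or_mem ((Submodule.add_mem_iff_right q (h𝔞q hu)).mp hw)).resolve_right hrq
    exact Submodule.add_mem_sup hu (mul_comm r t ▸ Submodule.smul_mem_smul hr ht)
  rwa [le_antisymm h𝔞q hle]

variable {σ : Type*} [Fintype σ] {s : σ → R}

theorem ringKrullDim_quotient_span_image_compl [DecidableEq σ]
    (hdim : ringKrullDim R = Fintype.card σ)
    (hm : IsLocalRing.maximalIdeal R = Ideal.span (Set.range s)) (U : Finset σ) :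
    ringKrullDim (R ⧸ Ideal.span (s '' (Uᶜ : Finset σ))) = U.card := by
  classical
  have hsub (T : Finset σ) : ((T.image s : Finset R) : Set R) ⊆ Ring.jacobson R := by
    rw [IsLocalRing.ringJacobson_eq_maximalIdeal, hm, Finset.coe_image]
    exact (Set.image_subset_range s T).trans Ideal.subset_span
  have hsup : Ideal.span (s '' (Uᶜ : Finset σ)) ⊔ Ideal.span (s '' U) =
      IsLocalRing.maximalIdeal R := by
    rw [hm, ← Ideal.span_union, ← Set.image_union, Finset.coe_compl, Set.compl_union_self,
      Set.image_univ]
  apply le_antisymm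
  · have h := ringKrullDim_quotient_le_quotient_sup_span_add_card
      (Ideal.span (s '' (Uᶜ : Finset σ))) (hsub U)
    have hfield : ringKrullDim (R ⧸ IsLocalRing.maximalIdeal R) = 0 :=
      ringKrullDim_eq_zero_of_field (IsLocalRing.ResidueField R)
    rw [Finset.coe_image, hsup, hfield, zero_add] at h
    exact h.trans (by gcongr; exact Finset.card_image_le)
  · have h := ringKrullDim_le_ringKrullDim_quotient_add_card _ (hsub Uᶜ)
    rw [hdim, Finset.coe_image, ← Finset.card_add_card_compl U, Nat.cast_add] at h
    exact ENat.WithBot.add_le_add_natCast_right_iff.mp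
      (h.trans (by gcongr; exact Finset.card_image_le))

theorem isPrime_span_image_compl [DecidableEq σ] (hdim : ringKrullDim R = Fintype.card σ)
    (hm : IsLocalRing.maximalIdeal R = Ideal.span (Set.range s)) (U : Finset σ) :
    (Ideal.span (s '' (Uᶜ : Finset σ))).IsPrime := by
  induction U using Finset.induction with
  | empty =>
    rw [Finset.compl_empty, Finset.coe_univ, Set.image_univ, ← hm]
    infer_instance
  | insert i U hi ih =>
    have hsup : Ideal.span (s '' ((insert i U)ᶜ : Finset σ)) ⊔ Ideal.span {s i} =
        Ideal.span (s '' (Uᶜ : Finset σ)) := by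
      rw [← Ideal.span_union, ← Set.image_singleton, ← Set.image_union, ← Finset.coe_singleton,
        ← Finset.coe_union, Finset.compl_insert, Finset.union_comm, ← Finset.insert_eq,
        Finset.insert_erase (by simpa using hi)]
    refine isPrime_of_isPrime_sup_span (r := s i) (n := U.card)
      (hm ▸ Ideal.subset_span (Set.mem_range_self i)) (hsup ▸ ih) ?_ ?_
    · rw [hsup, ringKrullDim_quotient_span_image_compl hdim hm]
    · rw [ringKrullDim_quotient_span_image_compl hdim hm, Finset.card_insert_of_notMem hi]

theorem isPrime_span_image (hdim : ringKrullDim R = Fintype.card σ)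
    (hm : IsLocalRing.maximalIdeal R = Ideal.span (Set.range s)) (T : Finset σ) :
    (Ideal.span (s '' T)).IsPrime := by
  classical
  simpa only [compl_compl] using isPrime_span_image_compl hdim hm Tᶜ

theorem notMem_span_image (hdim : ringKrullDim R = Fintype.card σ)
    (hm : IsLocalRing.maximalIdeal R = Ideal.span (Set.range s)) {T : Finset σ} {i : σ}
    (hi : i ∉ T) : s i ∉ Ideal.span (s '' T) := fun h => by
  classical
  have heq : Ideal.span (s '' (insert i T : Finset σ)) = Ideal.span (s '' T) := by
    rw [Finset.coe_insert, Set.image_insert_eq, Ideal.span_insert,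
      sup_eq_right.mpr ((Ideal.span_singleton_le_iff_mem _).mpr h)]
  have h1 := ringKrullDim_quotient_span_image_compl hdim hm (insert i T)ᶜ
  have h2 := ringKrullDim_quotient_span_image_compl hdim hm Tᶜ
  rw [compl_compl] at h1 h2
  rw [heq, h2] at h1
  have hcard : Tᶜ.card = (insert i T)ᶜ.card := by exact_mod_cast h1
  rw [Finset.compl_insert, Finset.card_erase_of_mem (by simpa using hi)] at hcard
  have : 0 < Tᶜ.card := Finset.card_pos.mpr ⟨i, by simpa using hi⟩
  omega

theorem isPermutablyRegular_of_maximalIdeal_eq_span (hdim : ringKrullDim R = Fintype.card σ)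
    (hm : IsLocalRing.maximalIdeal R = Ideal.span (Set.range s)) : IsPermutablyRegular s := by
  intro T i hi
  lift T to Finset σ using T.toFinite
  exact (isSMulRegular_quotient_iff_mem_of_smul_mem _ _).mpr fun _ hc =>
    ((isPrime_span_image hdim hm T).mem_or_mem hc).resolve_left (notMem_span_image hdim hm hi)

end RegularParameters

section QuasiRegular

variable {R : Type*} [CommRing R]

theorem isSMulRegular_quotient_sup_span_pow {K : Ideal R} {r t : R}
    (hr : IsSMulRegular (R ⧸ K ⊔ Ideal.span {t}) r) (ht : IsSMulRegular (R ⧸ K) t) (n : ℕ) :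
    IsSMulRegular (R ⧸ K ⊔ Ideal.span {t ^ n}) r := by
  simp only [isSMulRegular_quotient_iff_mem_of_smul_mem, smul_eq_mul, Submodule.mem_sup,
    Ideal.mem_span_singleton', exists_exists_eq_and] at *
  induction n with
  | zero => exact fun c _ => ⟨0, K.zero_mem, c, by ring⟩
  | succ n ih =>
    rintro c ⟨k, hk, w, hw⟩
    obtain ⟨k', hk', c', rfl⟩ := hr c ⟨k, hk, w * t ^ n, by rw [← hw]; ring⟩
    have hc' : r * c' - w * t ^ n ∈ K := ht _ (by
      have h := sub_mem hk (K.mul_mem_left r hk')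
      rwa [eq_sub_of_add_eq hw,
        show r * (k' + c' * t) - w * t ^ (n + 1) - r * k' = t * (r * c' - w * t ^ n) by ring] at h)
    obtain ⟨k'', hk'', w', rfl⟩ := ih c' ⟨_, hc', w, by ring⟩
    exact ⟨k' + k'' * t, K.add_mem hk' (K.mul_mem_right t hk''), w', by ring⟩

variable {σ : Type*} {s : σ → R}

theorem span_image_update_insert [DecidableEq σ] (s : σ → R) (i : σ) (t : R) (T : Set σ) :
    Ideal.span (Function.update s i t '' insert i T) =
      Ideal.span (s '' (T \ {i})) ⊔ Ideal.span {t} := by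
  have himage : Function.update s i t '' (T \ {i}) = s '' (T \ {i}) :=
    Set.image_congr fun j hj => Function.update_of_ne hj.2 t s
  rw [← Set.insert_sdiff_singleton, Set.image_insert_eq, Function.update_self, himage,
    Ideal.span_insert, sup_comm]

namespace IsPermutablyRegular

variable [DecidableEq σ]

theorem update_pow (hs : IsPermutablyRegular s) (i : σ) (n : ℕ) :
    IsPermutablyRegular (Function.update s i (s i ^ n)) := by
  intro T j hj
  by_cases hi : i ∈ T
  · rw [Function.update_of_ne (by rintro rfl; exact hj hi), ← Set.insert_eq_of_mem hi,
      span_image_update_insert]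
    refine isSMulRegular_quotient_sup_span_pow ?_ (hs _ i (by simp)) n
    have h := hs T j hj
    rwa [← Function.update_eq_self i s, ← Set.insert_eq_of_mem hi, span_image_update_insert,
      Function.update_eq_self] at h
  · have himage : Function.update s i (s i ^ n) '' T = s '' T :=
      Set.image_congr fun k hk => Function.update_of_ne (by rintro rfl; exact hi hk) _ s
    rw [himage]
    obtain rfl | hji := eq_or_ne j i
    · rw [Function.update_self]
      exact (hs T j hj).pow n
    · rw [Function.update_of_ne hji]
      exact hs T j hj

theorem piecewise_pow (hs : IsPermutablyRegular s) (B : Finset σ) (m : σ → ℕ) :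
    IsPermutablyRegular (B.piecewise (fun i => s i ^ m i) s) := by
  induction B using Finset.induction with
  | empty => rwa [Finset.piecewise_empty]
  | insert i B hi ih =>
    rw [Finset.piecewise_insert]
    simpa only [Finset.piecewise_eq_of_notMem _ _ _ hi] using ih.update_pow i (m i)

theorem mem_span_range_of_mul_pow_mem (hs : IsPermutablyRegular s) {i : σ} {n : ℕ} {c : R}
    (h : c * s i ^ n ∈ Ideal.span (Set.range (Function.update s i (s i ^ (n + 1))))) :
    c ∈ Ideal.span (Set.range s) := by
  have hspan (t : R) : Ideal.span (Set.range (Function.update s i t)) =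
      Ideal.span (s '' (Set.univ \ {i})) ⊔ Ideal.span {t} := by
    rw [← Set.image_univ, ← span_image_update_insert, Set.insert_eq_of_mem (Set.mem_univ i)]
  rw [hspan] at h
  rw [← Function.update_eq_self i s, hspan]
  obtain ⟨k, hk, w, hw, hkw⟩ := Submodule.mem_sup.mp h
  obtain ⟨w, rfl⟩ := Ideal.mem_span_singleton'.mp hw
  have hmem : c - w * s i ∈ Ideal.span (s '' (Set.univ \ {i})) := by
    refine mem_of_isSMulRegular_quotient_of_smul_mem ((hs _ i (by simp)).pow n) ?_
    rwa [smul_eq_mul, show s i ^ n * (c - w * s i) = k by linear_combination -hkw]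
  exact Submodule.mem_sup.mpr
    ⟨_, hmem, _, Ideal.mul_mem_left _ w (Ideal.mem_span_singleton_self _), sub_add_cancel c _⟩

theorem mem_span_range_of_mul_prod_mem (hs : IsPermutablyRegular s) (B : Finset σ) (m : σ → ℕ)
    {c : R} (h : c * ∏ i ∈ B, s i ^ m i ∈
      Ideal.span (Set.range (B.piecewise (fun i => s i ^ (m i + 1)) s))) :
    c ∈ Ideal.span (Set.range s) := by
  induction B using Finset.induction generalizing c with
  | empty => simpa using h
  | insert i B hi ih =>
    have hpiece : B.piecewise (fun i => s i ^ (m i + 1)) s i = s i :=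
      Finset.piecewise_eq_of_notMem _ _ _ hi
    rw [Finset.prod_insert hi, mul_comm (s i ^ m i), ← mul_assoc, Finset.piecewise_insert] at h
    refine ih ((hs.piecewise_pow B fun i => m i + 1).mem_span_range_of_mul_pow_mem
      (i := i) (n := m i) ?_)
    rwa [hpiece]

end IsPermutablyRegular

open MvPolynomial

theorem eval_mem_span_pow_succ_of_coeff_eq_zero {P : MvPolynomial σ R} {α : σ →₀ ℕ}
    (h : ∀ β ≤ α, P.coeff β = 0) :
    eval s P ∈ Ideal.span (Set.range fun i => s i ^ (α i + 1)) := by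
  rw [eval_eq]
  refine Ideal.sum_mem _ fun β hβ => Ideal.mul_mem_left _ _ ?_
  obtain ⟨i, hi⟩ : ∃ i, α i < β i := by
    by_contra! hle
    exact mem_support_iff.mp hβ (h β hle)
  have hiβ : i ∈ β.support := Finsupp.mem_support_iff.mpr (Nat.ne_zero_of_lt hi)
  exact Ideal.mem_of_dvd _
    ((pow_dvd_pow _ hi).trans (Finset.dvd_prod_of_mem (fun j => s j ^ β j) hiβ))
    (Ideal.subset_span ⟨i, rfl⟩)

theorem IsPermutablyRegular.coeff_mem_of_eval_mem_pow [Finite σ] (hs : IsPermutablyRegular s)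
    {P : MvPolynomial σ R} {n : ℕ} (hP : P.IsHomogeneous n)
    (h : eval s P ∈ Ideal.span (Set.range s) ^ (n + 1)) (α : σ →₀ ℕ) :
    P.coeff α ∈ Ideal.span (Set.range s) := by
  classical
  have := Fintype.ofFinite σ
  by_cases hα : α.degree = n
  swap
  · rw [hP.coeff_eq_zero hα]
    exact zero_mem _
  obtain ⟨Q, hQ, hQP⟩ := (Ideal.mem_span_pow_iff_exists_isHomogeneous _ _).mp h
  have hcoeff : ∀ β ≤ α, (Q - (P - monomial α (P.coeff α))).coeff β = 0 := fun β hβ => by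
    have hQβ : Q.coeff β = 0 := hQ.coeff_eq_zero fun hdeg => by
      have := Finsupp.degree_mono hβ
      omega
    obtain rfl | hne := eq_or_ne α β
    · simp [hQβ]
    · have hPβ : P.coeff β = 0 := hP.coeff_eq_zero fun hdeg => hne <| by
        obtain ⟨γ, rfl⟩ := le_iff_exists_add.mp hβ
        have hγ : γ.degree = 0 := by rw [map_add] at hα; omega
        rw [(Finsupp.degree_eq_zero_iff γ).mp hγ, add_zero]
      simp [hQβ, hPβ, hne]
  have hmem := eval_mem_span_pow_succ_of_coeff_eq_zero (s := s) hcoeff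
  rw [map_sub, hQP, map_sub, sub_sub_cancel, eval_monomial,
    Finsupp.prod_fintype _ _ fun i => pow_zero _] at hmem
  refine hs.mem_span_range_of_mul_prod_mem Finset.univ α ?_
  rwa [Finset.piecewise_univ]

theorem map_residue_eq_zero_of_eval_mem_pow [IsLocalRing R] [IsNoetherianRing R] [Fintype σ]
    (hdim : ringKrullDim R = Fintype.card σ)
    (hm : IsLocalRing.maximalIdeal R = Ideal.span (Set.range s)) {P : MvPolynomial σ R} {n : ℕ}
    (hP : P.IsHomogeneous n) (h : eval s P ∈ IsLocalRing.maximalIdeal R ^ (n + 1)) :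
    map (IsLocalRing.residue R) P = 0 := by
  ext α
  rw [coeff_map, coeff_zero, IsLocalRing.residue_eq_zero_iff, hm]
  exact (isPermutablyRegular_of_maximalIdeal_eq_span hdim hm).coeff_mem_of_eval_mem_pow hP
    (hm ▸ h) α

end QuasiRegular

section ReesAdjoin

variable {R : Type*} [CommRing R]

/-- The component of degree `n` of the subalgebra `R[I t, d t²]` of `R[t]`, that is the ideal
`∑ dᵏ Iⁿ⁻²ᵏ` with `k` running over `0 ≤ k ≤ n / 2`. -/
def reesAdjoin (I : Ideal R) (d : R) : ℕ → Ideal R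
  | 0 => ⊤
  | 1 => I
  | n + 2 => I ^ (n + 2) ⊔ Ideal.span {d} * reesAdjoin I d n

variable {I : Ideal R} {d : R}

theorem mem_reesAdjoin_add_two {n : ℕ} {r : R} : r ∈ reesAdjoin I d (n + 2) ↔
    ∃ u ∈ I ^ (n + 2), ∃ t ∈ reesAdjoin I d n, u + d * t = r := by
  simp only [reesAdjoin, Submodule.mem_sup, Ideal.mem_span_singleton_mul, exists_exists_and_eq_and]

theorem pow_le_reesAdjoin (I : Ideal R) (d : R) : ∀ n, I ^ n ≤ reesAdjoin I d n
  | 0 => le_top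
  | 1 => (pow_one I).le
  | _ + 2 => le_sup_left

theorem mul_mem_reesAdjoin_add_two {n : ℕ} {r : R} (h : r ∈ reesAdjoin I d n) :
    d * r ∈ reesAdjoin I d (n + 2) :=
  mem_reesAdjoin_add_two.mpr ⟨0, zero_mem _, r, h, zero_add _⟩

theorem ideal_mul_reesAdjoin_le (I : Ideal R) (d : R) :
    ∀ n, I * reesAdjoin I d n ≤ reesAdjoin I d (n + 1)
  | 0 => (Ideal.mul_top I).le
  | 1 => (pow_two I).ge.trans (pow_le_reesAdjoin I d 2)
  | n + 2 => by
    rw [reesAdjoin, reesAdjoin, Ideal.mul_sup, ← pow_succ', mul_left_comm]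
    exact sup_le_sup_left (Ideal.mul_mono_right (ideal_mul_reesAdjoin_le I d n)) _

theorem pow_add_two_le_of_sq_le {a : R} (ha : a ∈ I)
    (hsq : I ^ 2 ≤ Ideal.span {a} * I ⊔ Ideal.span {d}) :
    ∀ n, I ^ (n + 2) ≤ Ideal.span {a ^ (n + 1)} * I ⊔ Ideal.span {d} * reesAdjoin I d n
  | 0 => by simpa only [zero_add, pow_one, reesAdjoin, Ideal.mul_top] using hsq
  | n + 1 => by
    have hdn : Ideal.span {d} * I ^ (n + 1) ≤ Ideal.span {d} * reesAdjoin I d (n + 1) :=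
      Ideal.mul_mono_right (pow_le_reesAdjoin I d _)
    have han : Ideal.span {a} * reesAdjoin I d n ≤ reesAdjoin I d (n + 1) :=
      (Ideal.mul_mono_left ((Ideal.span_singleton_le_iff_mem I).mpr ha)).trans
        (ideal_mul_reesAdjoin_le I d n)
    calc I ^ (n + 1 + 2) = I ^ 2 * I ^ (n + 1) := by rw [← pow_add, add_comm]
      _ ≤ (Ideal.span {a} * I ⊔ Ideal.span {d}) * I ^ (n + 1) := Ideal.mul_mono_left hsq
      _ = Ideal.span {a} * I ^ (n + 2) ⊔ Ideal.span {d} * I ^ (n + 1) := by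
        rw [Ideal.sup_mul, mul_assoc, ← pow_succ']
      _ ≤ Ideal.span {a} * (Ideal.span {a ^ (n + 1)} * I ⊔ Ideal.span {d} * reesAdjoin I d n) ⊔
          Ideal.span {d} * reesAdjoin I d (n + 1) :=
        sup_le_sup (Ideal.mul_mono_right (pow_add_two_le_of_sq_le ha hsq n)) hdn
      _ ≤ _ := by
        rw [Ideal.mul_sup, ← mul_assoc, Ideal.span_singleton_mul_span_singleton, ← pow_succ',
          mul_left_comm, sup_assoc]
        exact sup_le_sup_left (sup_le (Ideal.mul_mono_right han) le_rfl) _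

/-- Division of a relation by `x`, where `x, a, d` is a regular sequence. -/
theorem exists_eq_of_mul_eq_pow_mul_add {a x : R} (hd : d ∈ I) (hx : IsSMulRegular R x)
    (hxa : IsSMulRegular (R ⧸ Ideal.span {x}) a)
    (hxad : IsSMulRegular (R ⧸ Ideal.span {x} ⊔ Ideal.span {a}) d)
    (hxI : IsSMulRegular (R ⧸ I) x) {n : ℕ} {r w s : R} (hw : w ∈ I)
    (h : x * r = a ^ n * w + d * s) :
    ∃ w' ∈ I, ∃ q s', r = a ^ n * w' + d * q ∧ s = x * q + a ^ n * s' := by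
  have hds : d • s ∈ Ideal.span {x} ⊔ Ideal.span {a ^ n} :=
    Submodule.mem_sup.mpr ⟨x * r, Ideal.mul_mem_right _ _ (Ideal.mem_span_singleton_self x),
      -(a ^ n * w), neg_mem (Ideal.mul_mem_right _ _ (Ideal.mem_span_singleton_self _)),
      by rw [smul_eq_mul]; linear_combination h⟩
  obtain ⟨_, hq, _, hs', rfl⟩ := Submodule.mem_sup.mp
    (mem_of_isSMulRegular_quotient_of_smul_mem (isSMulRegular_quotient_sup_span_pow hxad hxa _) hds)
  obtain ⟨q, rfl⟩ := Ideal.mem_span_singleton.mp hq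
  obtain ⟨s', rfl⟩ := Ideal.mem_span_singleton.mp hs'
  have hxw : a ^ n • (w + d * s') ∈ Ideal.span {x} :=
    Ideal.mem_span_singleton.mpr ⟨r - d * q, by rw [smul_eq_mul]; linear_combination -h⟩
  obtain ⟨w', hw'⟩ := Ideal.mem_span_singleton.mp
    (mem_of_isSMulRegular_quotient_of_smul_mem (hxa.pow n) hxw)
  have hw'I : w' ∈ I := mem_of_isSMulRegular_quotient_of_smul_mem hxI
    (hw'.subst (I.add_mem hw (I.mul_mem_right s' hd)))
  refine ⟨w', hw'I, q, s', hx ?_, rfl⟩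
  simp only [smul_eq_mul]
  linear_combination h + a ^ n * hw'

theorem isSMulRegular_quotient_reesAdjoin {a x : R} (ha : a ∈ I) (hd : d ∈ I)
    (hsq : I ^ 2 ≤ Ideal.span {a} * I ⊔ Ideal.span {d}) (hx : IsSMulRegular R x)
    (hxa : IsSMulRegular (R ⧸ Ideal.span {x}) a)
    (hxad : IsSMulRegular (R ⧸ Ideal.span {x} ⊔ Ideal.span {a}) d)
    (hxI : IsSMulRegular (R ⧸ I) x) : ∀ n, IsSMulRegular (R ⧸ reesAdjoin I d n) x
  | 0 => (isSMulRegular_quotient_iff_mem_of_smul_mem _ _).mpr fun _ _ => Submodule.mem_top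
  | 1 => hxI
  | n + 2 => by
    refine (isSMulRegular_quotient_iff_mem_of_smul_mem _ _).mpr fun r hr => ?_
    obtain ⟨u, hu, t, ht, hut⟩ := Submodule.mem_sup.mp
      (sup_le (pow_add_two_le_of_sq_le ha hsq n) le_sup_right hr)
    obtain ⟨w, hw, rfl⟩ := Ideal.mem_span_singleton_mul.mp hu
    obtain ⟨s, hs, rfl⟩ := Ideal.mem_span_singleton_mul.mp ht
    obtain ⟨w', hw', q, s', rfl, rfl⟩ :=
      exists_eq_of_mul_eq_pow_mul_add hd hx hxa hxad hxI hw hut.symm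
    have has' : a ^ (n + 1) * s' ∈ reesAdjoin I d n := Ideal.mul_mem_right s' _
      (pow_le_reesAdjoin I d n (Ideal.pow_le_pow_right n.le_succ (Ideal.pow_mem_pow ha _)))
    have hq : q ∈ reesAdjoin I d n := mem_of_isSMulRegular_quotient_of_smul_mem
      (isSMulRegular_quotient_reesAdjoin ha hd hsq hx hxa hxad hxI n)
      ((Submodule.add_mem_iff_left _ has').mp hs)
    refine mem_reesAdjoin_add_two.mpr ⟨a ^ (n + 1) * w', ?_, q, hq, rfl⟩
    rw [pow_succ]
    exact Ideal.mul_mem_mul (Ideal.pow_mem_pow ha _) hw'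

theorem exists_pow_mul_mem_pow_of_mem_reesAdjoin {x : R} (hxd : x * d ∈ I ^ 2) :
    ∀ {n : ℕ} {r : R}, r ∈ reesAdjoin I d n → ∃ k, x ^ k * r ∈ I ^ n
  | 0, r, _ => ⟨0, by simp⟩
  | 1, r, hr => ⟨0, by simpa [reesAdjoin] using hr⟩
  | n + 2, r, hr => by
    obtain ⟨u, hu, t, ht, rfl⟩ := mem_reesAdjoin_add_two.mp hr
    obtain ⟨k, hk⟩ := exists_pow_mul_mem_pow_of_mem_reesAdjoin hxd ht
    refine ⟨k + 1, ?_⟩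
    have hdt : x * d * (x ^ k * t) ∈ I ^ (n + 2) := by
      rw [add_comm, pow_add]
      exact Ideal.mul_mem_mul hxd hk
    convert add_mem (Ideal.mul_mem_left _ (x ^ (k + 1)) hu) hdt using 1
    ring

theorem mem_symbolicPower_iff {n : ℕ} {r : R} :
    r ∈ symbolicPower I n ↔ ∀ p ∈ I.minimalPrimes, ∃ t ∉ p, t * r ∈ I ^ n := by
  rw [symbolicPower, Submodule.mem_iInf]
  constructor
  · intro h p hp
    exact (IsLocalization.algebraMap_mem_map_algebraMap_iff (p.primeCompl (hp := hp.1.1)) _ _ _).mp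
      (h ⟨⟨p, hp.1.1⟩, hp⟩)
  · intro h p
    exact (IsLocalization.algebraMap_mem_map_algebraMap_iff p.1.asIdeal.primeCompl _ _ _).mpr
      (h _ p.2)

theorem symbolicPower_eq_of_isSMulRegular {J : Ideal R} {n : ℕ} {x : R} (hIJ : I ^ n ≤ J)
    (hJ : ∀ r ∈ J, ∃ k, x ^ k * r ∈ I ^ n) (hxI : IsSMulRegular (R ⧸ I) x)
    (hxJ : IsSMulRegular (R ⧸ J) x)
    (hx : ∀ Q : Ideal R, Q.IsPrime → I ≤ Q → Q ∉ I.minimalPrimes → x ∈ Q) :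
    symbolicPower I n = J := by
  ext r
  rw [mem_symbolicPower_iff]
  constructor
  · intro h
    have hrad : x ∈ Ideal.radical (Submodule.comap (LinearMap.mulRight R r) (I ^ n)) := by
      rw [Ideal.radical_eq_sInf, Submodule.mem_sInf]
      rintro Q ⟨hKQ, hQ⟩
      refine hx Q hQ (hQ.le_of_pow_le fun t ht => hKQ (Ideal.mul_mem_right r _ ht)) fun hQmin => ?_
      obtain ⟨t, htQ, ht⟩ := h Q hQmin
      exact htQ (hKQ ht)
    obtain ⟨k, hk⟩ := hrad
    exact mem_of_isSMulRegular_quotient_of_smul_mem (hxJ.pow k) (hIJ hk)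
  · intro hr p hp
    obtain ⟨k, hk⟩ := hJ r hr
    refine ⟨x ^ k, fun hxk => ?_, hk⟩
    obtain ⟨t, ht, hxt⟩ :=
      Ideal.exists_mul_mem_of_mem_minimalPrimes hp (hp.1.1.mem_of_pow_mem k hxk)
    exact ht (mem_of_isSMulRegular_quotient_of_smul_mem hxI hxt)

end ReesAdjoin

section Length

open MvPolynomial

variable {R : Type*} [CommRing R]

theorem length_quotient_submoduleOf_add {M : Type*} [AddCommGroup M] [Module R M]
    {K L J : Submodule R M} (hKL : K ≤ L) (hLJ : L ≤ J) :
    Module.length R (J ⧸ K.submoduleOf J) =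
      Module.length R (L ⧸ K.submoduleOf L) + Module.length R (J ⧸ L.submoduleOf J) := by
  have hKLJ : K.submoduleOf J ≤ L.submoduleOf J := fun _ h => hKL h
  have hincl : K.submoduleOf L ≤ (K.submoduleOf J).comap (Submodule.inclusion hLJ) := fun _ h => h
  refine Module.length_eq_add_of_exact (Submodule.mapQ _ _ (Submodule.inclusion hLJ) hincl)
    (Submodule.factor hKLJ) ?_ (Submodule.factor_surjective hKLJ) ?_
  · rw [← LinearMap.ker_eq_bot, Submodule.ker_mapQ]
    exact Submodule.mkQ_map_self _
  · rw [LinearMap.exact_iff, Submodule.factor, Submodule.ker_mapQ, Submodule.range_mapQ,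
      Submodule.range_inclusion, Submodule.comap_id]
    rfl

theorem length_quotient_eq_of_surjective {M N : Type*} [AddCommGroup M] [Module R M]
    [AddCommGroup N] [Module R N] {K : Submodule R M} (f : M →ₗ[R] N) (hf : Function.Surjective f)
    (hK : LinearMap.ker f = K) : Module.length R (M ⧸ K) = Module.length R N := by
  subst hK
  exact (f.quotKerEquivOfSurjective hf).length_eq

variable {ι : Type*}

theorem eval_mem_mul_span_range_pow {K : Ideal R} {g : ι → R} {P : MvPolynomial ι R} {n : ℕ}
    (hP : P.IsHomogeneous n) (hK : ∀ α, P.coeff α ∈ K) :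
    eval g P ∈ K * Ideal.span (Set.range g) ^ n := by
  rw [eval_eq]
  refine Ideal.sum_mem _ fun α hα => Ideal.mul_mem_mul (hK α) ?_
  have hα : α.degree = n := by
    by_contra hne
    exact mem_support_iff.mp hα (hP.coeff_eq_zero hne)
  exact (Ideal.mem_span_pow_iff_exists_isHomogeneous g _).mpr
    ⟨monomial α 1, isHomogeneous_monomial 1 hα, by rw [eval_monomial, one_mul, Finsupp.prod]⟩

theorem enatCard_setOf_degree_eq (ι : Type*) [Fintype ι] (n : ℕ) :
    ENat.card {α : ι →₀ ℕ | α.degree = n} = ((Fintype.card ι).multichoose n : ℕ) := by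
  classical
  rw [← Sym.card_sym_eq_multichoose, ← ENat.card_eq_coe_fintype_card]
  exact ENat.card_congr (Sym.equivNatSum ι n).symm

theorem length_homogeneousSubmodule_quotient [Fintype ι] {m : Ideal R} [hm : m.IsMaximal] {n : ℕ}
    {N : Submodule R (homogeneousSubmodule ι R n)} (hN : ∀ P, P ∈ N ↔ ∀ α, P.1.coeff α ∈ m) :
    Module.length R (homogeneousSubmodule ι R n ⧸ N) = ((Fintype.card ι).multichoose n : ℕ) := by
  let coeffs : homogeneousSubmodule ι R n ≃ₗ[R] ({α : ι →₀ ℕ | α.degree = n} →₀ R) :=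
    LinearEquiv.ofEq _ _ (homogeneousSubmodule_eq_finsupp_supported ι R n) ≪≫ₗ
      AddMonoidAlgebra.supportedEquivFinsupp _
  let f := Finsupp.mapRange.linearMap m.mkQ ∘ₗ coeffs.toLinearMap
  have hf : Function.Surjective f :=
    (Finsupp.mapRange_surjective _ (map_zero _) m.mkQ_surjective).comp coeffs.surjective
  have hker : LinearMap.ker f = N := by
    ext P
    rw [LinearMap.mem_ker, Finsupp.ext_iff, hN]
    refine ⟨fun h α => ?_, fun h α => (Submodule.Quotient.mk_eq_zero m).mpr (h α)⟩
    by_cases hα : α.degree = n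
    · exact (Submodule.Quotient.mk_eq_zero m).mp (h ⟨α, hα⟩)
    · rw [P.2.coeff_eq_zero hα]
      exact m.zero_mem
  have : IsSimpleModule R (R ⧸ m) := isSimpleModule_iff_isCoatom.mpr hm.out
  rw [length_quotient_eq_of_surjective f hf hker, Module.length_finsupp, Module.length_eq_one,
    mul_one, enatCard_setOf_degree_eq]

theorem length_span_range_pow_quotient [IsLocalRing R] [Fintype ι] {g : ι → R} {n : ℕ}
    (hg : ∀ P : MvPolynomial ι R, P.IsHomogeneous n →
      eval g P ∈ IsLocalRing.maximalIdeal R * Ideal.span (Set.range g) ^ n →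
        map (IsLocalRing.residue R) P = 0) :
    Module.length R (↥(Ideal.span (Set.range g) ^ n) ⧸
      (IsLocalRing.maximalIdeal R * Ideal.span (Set.range g) ^ n).submoduleOf
        (Ideal.span (Set.range g) ^ n)) = ((Fintype.card ι).multichoose n : ℕ) := by
  let f : homogeneousSubmodule ι R n →ₗ[R] _ :=
    ((IsLocalRing.maximalIdeal R * Ideal.span (Set.range g) ^ n).submoduleOf _).mkQ ∘ₗ
      (aeval g).toLinearMap.restrict (q := Ideal.span (Set.range g) ^ n) fun P hP =>
        (Ideal.mem_span_pow_iff_exists_isHomogeneous g _).mpr ⟨P, hP, rfl⟩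
  have hf : Function.Surjective f := (Submodule.mkQ_surjective _).comp fun ⟨r, hr⟩ => by
    obtain ⟨P, hP, rfl⟩ := (Ideal.mem_span_pow_iff_exists_isHomogeneous g r).mp hr
    exact ⟨⟨P, hP⟩, rfl⟩
  have hker (P) : P ∈ LinearMap.ker f ↔ ∀ α, P.1.coeff α ∈ IsLocalRing.maximalIdeal R := by
    refine (LinearMap.mem_ker.trans (Submodule.Quotient.mk_eq_zero _)).trans
      ⟨fun h α => ?_, eval_mem_mul_span_range_pow P.2⟩
    rw [← IsLocalRing.residue_eq_zero_iff, ← coeff_map, hg P.1 P.2 h, coeff_zero]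
  rw [← length_quotient_eq_of_surjective f hf rfl, length_homogeneousSubmodule_quotient hker]

end Length

section ClosedForm

theorem sum_choose_add_two (n : ℕ) :
    ∑ k ∈ Finset.Icc 1 ((n + 2) / 2), (n + 2 - 2 * k + 2).choose 2 =
      (n + 2).choose 2 + ∑ k ∈ Finset.Icc 1 (n / 2), (n - 2 * k + 2).choose 2 := by
  have hIcc (m : ℕ) : Finset.Icc 1 m = Finset.Ico 1 (m + 1) := by ext; simp
  rw [hIcc, hIcc, Finset.sum_Ico_eq_sum_range, Finset.sum_Ico_eq_sum_range,
    show (n + 2) / 2 + 1 - 1 = n / 2 + 1 - 1 + 1 by omega, Finset.sum_range_succ', add_comm]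
  congr 1
  exact Finset.sum_congr rfl fun k _ => by
    rw [show n + 2 - 2 * (1 + (k + 1)) = n - 2 * (1 + k) by omega]

theorem cast_choose_three (K : Type*) [Field K] [CharZero K] (n : ℕ) :
    ((n + 2).choose 3 : K) = (n + 2) * (n + 1) * n / 6 := by
  induction n with
  | zero => simp
  | succ n ih =>
    rw [show n + 1 + 2 = (n + 2) + 1 by ring, Nat.choose_succ_succ, Nat.cast_add, ih,
      Nat.cast_choose_two]
    push_cast
    field_simp
    ring

theorem cast_sum_choose (K : Type*) [Field K] [CharZero K] (n : ℕ) :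
    ((∑ k ∈ Finset.Icc 1 (n / 2), (n - 2 * k + 2).choose 2 : ℕ) : K) =
      1 / 2 * ((n + 2).choose 3 : K) - 1 / 4 * ((n + 1).choose 2 : K) - 1 / 8 * (n : K) -
        if Odd n then 1 / 8 else 0 := by
  induction n using Nat.twoStepInduction with
  | zero => simp
  | one => norm_num
  | more n ih _ =>
    rw [sum_choose_add_two, Nat.cast_add, ih]
    simp only [Nat.odd_add, even_two, iff_true]
    rw [cast_choose_three, cast_choose_three, Nat.cast_choose_two, Nat.cast_choose_two,
      Nat.cast_choose_two]
    push_cast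
    field_simp
    ring

theorem tendsto_sum_choose :
    Tendsto (fun n : ℕ => ((Nat.factorial 3 : ℕ) : ℝ) / (n : ℝ) ^ 3 *
      ((∑ k ∈ Finset.Icc 1 (n / 2), (n - 2 * k + 2).choose 2 : ℕ) : ℝ)) atTop (𝓝 (1 / 2)) := by
  have hu : Tendsto (fun n : ℕ => 1 / (n : ℝ)) atTop (𝓝 0) := tendsto_one_div_atTop_nhds_zero_nat
  have hδ : Tendsto (fun n : ℕ => (if Odd n then 1 else 0) * (1 / (n : ℝ))) atTop (𝓝 0) := by
    refine squeeze_zero (fun n => by positivity) (fun n => ?_) hu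
    have : (0 : ℝ) ≤ 1 / n := by positivity
    split_ifs <;> linarith
  have hlim : Tendsto (fun n : ℕ => 1 / 2 + 3 / 4 * (1 / (n : ℝ)) - 1 / 2 * (1 / (n : ℝ)) ^ 2 -
      3 / 4 * ((if Odd n then 1 else 0) * (1 / (n : ℝ))) * (1 / (n : ℝ)) ^ 2)
      atTop (𝓝 (1 / 2)) := by
    have := ((tendsto_const_nhds (x := (1 / 2 : ℝ))).add (hu.const_mul (3 / 4))).sub
      ((hu.pow 2).const_mul (1 / 2)) |>.sub ((hδ.const_mul (3 / 4)).mul (hu.pow 2))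
    simpa using this
  refine hlim.congr' ?_
  filter_upwards [eventually_ge_atTop 1] with n hn
  have hn0 : (n : ℝ) ≠ 0 := by positivity
  rw [cast_sum_choose, cast_choose_three, Nat.cast_choose_two,
    show ((Nat.factorial 3 : ℕ) : ℝ) = 6 by norm_num [Nat.factorial]]
  push_cast
  split_ifs <;> field_simp <;> ring

end ClosedForm

section Hankel

open MvPolynomial

variable {R : Type*} [CommRing R]

/-- The maximal minors of the matrix `(x, y, z; y, z, v x)`. -/
def hankelMinors (x y z v : R) : Fin 3 → R :=
  ![x * z - y ^ 2, v * x ^ 2 - y * z, v * x * y - z ^ 2]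

/-- The ideal of maximal minors of the matrix `(x, y, z; y, z, v x)`. -/
def hankelIdeal (x y z v : R) : Ideal R := Ideal.span (Set.range (hankelMinors x y z v))

/-- The element `d` of the ideal of minors whose products with `x`, `y` and `z` are quadratic forms
in the minors. -/
def hankelCubic (x y z v : R) : R := v ^ 2 * x ^ 3 - 3 * v * x * y * z + z ^ 3 + v * y ^ 3

variable {x y z v : R}

theorem hankelMinors_mem (i : Fin 3) : hankelMinors x y z v i ∈ hankelIdeal x y z v :=
  Ideal.subset_span ⟨i, rfl⟩

theorem mem_hankelIdeal_iff {r : R} : r ∈ hankelIdeal x y z v ↔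
    ∃ r₀ r₁ r₂ : R, r = r₀ * (x * z - y ^ 2) + r₁ * (v * x ^ 2 - y * z) +
      r₂ * (v * x * y - z ^ 2) := by
  rw [hankelIdeal, Ideal.mem_span_range_iff_exists_fun]
  simp only [Fin.sum_univ_three]
  exact ⟨fun ⟨c, hc⟩ => ⟨c 0, c 1, c 2, hc.symm⟩, fun ⟨r₀, r₁, r₂, h⟩ => ⟨![r₀, r₁, r₂], h.symm⟩⟩

theorem hankelCubic_mem : hankelCubic x y z v ∈ hankelIdeal x y z v :=
  mem_hankelIdeal_iff.mpr ⟨-(v * y), v * x, -z, by rw [hankelCubic]; ring⟩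

theorem mul_hankelCubic_mem_sq {r : R} (hr : r ∈ Ideal.span (Set.range ![x, y, z])) :
    r * hankelCubic x y z v ∈ hankelIdeal x y z v ^ 2 := by
  obtain ⟨c, rfl⟩ := Ideal.mem_span_range_iff_exists_fun.mp hr
  set m := hankelMinors x y z v with hm
  have mem (t : R) (i j : Fin 3) : t * (m i * m j) ∈ hankelIdeal x y z v ^ 2 := by
    rw [pow_two]
    exact Ideal.mul_mem_left _ t (Ideal.mul_mem_mul (hankelMinors_mem i) (hankelMinors_mem j))
  have hrel : (∑ i, c i * ![x, y, z] i) * hankelCubic x y z v =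
      c 0 * (m 1 * m 1) + -c 0 * (m 0 * m 2) + (c 1 * (m 1 * m 2) + c 1 * v * (m 0 * m 0)) +
        (c 2 * (m 2 * m 2) + c 2 * v * (m 0 * m 1)) := by
    simp only [hm, hankelMinors, hankelCubic, Fin.sum_univ_three, Matrix.cons_val]
    ring
  rw [hrel]
  exact add_mem (add_mem (add_mem (mem _ 1 1) (mem _ 0 2)) (add_mem (mem _ 1 2) (mem _ 0 0)))
    (add_mem (mem _ 2 2) (mem _ 0 1))

theorem hankelIdeal_sq_le : hankelIdeal x y z v ^ 2 ≤
    Ideal.span {x * z - y ^ 2} * hankelIdeal x y z v ⊔ Ideal.span {hankelCubic x y z v} := by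
  rw [pow_two, Ideal.mul_le]
  intro r hr t ht
  obtain ⟨r₀, r₁, r₂, rfl⟩ := mem_hankelIdeal_iff.mp hr
  obtain ⟨t₀, t₁, t₂, rfl⟩ := mem_hankelIdeal_iff.mp ht
  have hu := mem_hankelIdeal_iff (x := x) (y := y) (z := z) (v := v).mpr
    ⟨r₀ * t₀ - v * (r₁ * t₂ + r₂ * t₁), r₀ * t₁ + r₁ * t₀ - v * r₂ * t₂,
      r₀ * t₂ + r₂ * t₀ + r₁ * t₁, rfl⟩
  refine Submodule.mem_sup.mpr ⟨_, Ideal.mul_mem_mul (Ideal.mem_span_singleton_self _) hu, _,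
    Ideal.mul_mem_right (r₁ * t₁ * x + (r₁ * t₂ + r₂ * t₁) * y + r₂ * t₂ * z) _
      (Ideal.mem_span_singleton_self _), ?_⟩
  rw [hankelCubic]
  ring

theorem isSMulRegular_quotient_of_sub_mem {K : Ideal R} {r t : R} (h : r - t ∈ K)
    (ht : IsSMulRegular (R ⧸ K) t) : IsSMulRegular (R ⧸ K) r :=
  (isSMulRegular_quotient_iff_mem_of_smul_mem _ _).mpr fun c hc =>
    mem_of_isSMulRegular_quotient_of_smul_mem ht <| by
      have := sub_mem hc (K.mul_mem_right c h)
      rwa [smul_eq_mul, ← sub_mul, sub_sub_cancel] at this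

theorem map_hankelMinors {S : Type*} [CommRing S] (f : R →+* S) (i : Fin 3) :
    f (hankelMinors x y z v i) = hankelMinors (f x) (f y) (f z) (f v) i := by
  fin_cases i <;> simp [hankelMinors]

theorem map_hankelCubic {S : Type*} [CommRing S] (f : R →+* S) :
    f (hankelCubic x y z v) = hankelCubic (f x) (f y) (f z) (f v) := by
  simp only [hankelCubic, map_add, map_sub, map_mul, map_pow, map_ofNat]

theorem isHomogeneous_hankelMinors (v : R) (i : Fin 3) :
    (hankelMinors (X 0) (X 1) (X 2) (C v) i : MvPolynomial (Fin 3) R).IsHomogeneous 2 := by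
  have hX := isHomogeneous_X R (σ := Fin 3)
  fin_cases i
  · exact ((hX 0).mul (hX 2)).sub ((hX 1).pow 2)
  · exact (((hX 0).pow 2).C_mul v).sub ((hX 1).mul (hX 2))
  · exact (((hX 0).C_mul v).mul (hX 1)).sub ((hX 2).pow 2)

theorem isHomogeneous_hankelCubic (v : R) :
    (hankelCubic (X 0) (X 1) (X 2) (C v) : MvPolynomial (Fin 3) R).IsHomogeneous 3 := by
  have hX := isHomogeneous_X R (σ := Fin 3)
  have h : (hankelCubic (X 0) (X 1) (X 2) (C v) : MvPolynomial (Fin 3) R) =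
      C (v ^ 2) * X 0 ^ 3 - C (3 * v) * (X 0 * X 1 * X 2) + X 2 ^ 3 + C v * X 1 ^ 3 := by
    simp only [hankelCubic, C_mul, C_pow, map_ofNat]
    ring
  rw [h]
  exact (((((hX 0).pow 3).C_mul _).sub ((((hX 0).mul (hX 1)).mul (hX 2)).C_mul _)).add
    ((hX 2).pow 3)).add (((hX 1).pow 3).C_mul v)

theorem eval_hankelMinors (i : Fin 3) :
    eval ![x, y, z] (hankelMinors (X 0) (X 1) (X 2) (C v) i) = hankelMinors x y z v i := by
  rw [map_hankelMinors]
  simp only [eval_X, eval_C, Matrix.cons_val]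

theorem eval_hankelCubic :
    eval ![x, y, z] (hankelCubic (X 0) (X 1) (X 2) (C v)) = hankelCubic x y z v := by
  rw [map_hankelCubic]
  simp only [eval_X, eval_C, Matrix.cons_val]

theorem hankelIdeal_le_sq : hankelIdeal x y z v ≤ Ideal.span (Set.range ![x, y, z]) ^ 2 := by
  rw [hankelIdeal, Ideal.span_le]
  rintro _ ⟨i, rfl⟩
  exact (Ideal.mem_span_pow_iff_exists_isHomogeneous _ _).mpr
    ⟨_, isHomogeneous_hankelMinors v i, eval_hankelMinors i⟩

theorem hankelCubic_mem_pow_three :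
    hankelCubic x y z v ∈ Ideal.span (Set.range ![x, y, z]) ^ 3 :=
  (Ideal.mem_span_pow_iff_exists_isHomogeneous _ _).mpr
    ⟨_, isHomogeneous_hankelCubic v, eval_hankelCubic⟩

theorem isSMulRegular_quotient_span_minor (hxy : IsSMulRegular (R ⧸ Ideal.span {x}) y) :
    IsSMulRegular (R ⧸ Ideal.span {x}) (x * z - y ^ 2) := by
  refine (isSMulRegular_quotient_iff_mem_of_smul_mem _ _).mpr fun c hc =>
    mem_of_isSMulRegular_quotient_of_smul_mem (hxy.pow 2) ?_
  have hxzc : z * c * x ∈ Ideal.span {x} := Ideal.mul_mem_left _ _ (Ideal.mem_span_singleton_self x)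
  convert sub_mem hxzc hc using 1
  simp only [smul_eq_mul]
  ring

theorem isSMulRegular_quotient_span_minor_hankelCubic
    (hxy : IsSMulRegular (R ⧸ Ideal.span {x}) y)
    (hxyz : IsSMulRegular (R ⧸ Ideal.span {x} ⊔ Ideal.span {y}) z) :
    IsSMulRegular (R ⧸ Ideal.span {x} ⊔ Ideal.span {x * z - y ^ 2}) (hankelCubic x y z v) := by
  have hspan : Ideal.span {x} ⊔ Ideal.span {x * z - y ^ 2} =
      Ideal.span {x} ⊔ Ideal.span {y ^ 2} := by
    rw [sub_eq_neg_add, ← Ideal.span_insert, Ideal.span_pair_add_left_mul, Ideal.span_insert,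
      Ideal.span_singleton_neg]
  rw [hspan]
  refine isSMulRegular_quotient_of_sub_mem (t := z ^ 3) ?_
    ((isSMulRegular_quotient_sup_span_pow hxyz hxy 2).pow 3)
  exact Submodule.mem_sup.mpr ⟨(v ^ 2 * x ^ 2 - 3 * v * y * z) * x,
    Ideal.mul_mem_left _ _ (Ideal.mem_span_singleton_self x), v * y * y ^ 2,
    Ideal.mul_mem_left _ _ (Ideal.mem_span_singleton_self _), by rw [hankelCubic]; ring⟩

theorem isSMulRegular_quotient_hankelIdeal (hx : IsSMulRegular R x)
    (hxy : IsSMulRegular (R ⧸ Ideal.span {x}) y)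
    (hxyz : IsSMulRegular (R ⧸ Ideal.span {x} ⊔ Ideal.span {y}) z) :
    IsSMulRegular (R ⧸ hankelIdeal x y z v) x := by
  -- Modulo `x` the coefficients form a syzygy of `y², yz, z²`, hence are of the shape
  -- `t (-z, y, 0) + q (0, -z, y)`, and both generators lift to syzygies of the minors.
  refine (isSMulRegular_quotient_iff_mem_of_smul_mem _ _).mpr fun r hr => ?_
  have dvd_of_dvd_mul {t : R} (h : x ∣ y * t) : x ∣ t :=
    Ideal.mem_span_singleton.mp (mem_of_isSMulRegular_quotient_of_smul_mem hxy
      (Ideal.mem_span_singleton.mpr h))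
  have exists_eq_of_mem {t : R} (h : t ∈ Ideal.span {x} ⊔ Ideal.span {y}) :
      ∃ p q, p * x + q * y = t := by
    rwa [← Ideal.span_insert, Ideal.mem_span_pair] at h
  obtain ⟨r₀, r₁, r₂, hr⟩ := mem_hankelIdeal_iff.mp hr
  rw [smul_eq_mul] at hr
  have hr₂ : z ^ 2 • r₂ ∈ Ideal.span {x} ⊔ Ideal.span {y} := by
    rw [← Ideal.span_insert, Ideal.mem_span_pair]
    exact ⟨r₀ * z + r₁ * v * x + r₂ * v * y - r, -(r₀ * y + r₁ * z), by
      rw [smul_eq_mul]; linear_combination -hr⟩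
  obtain ⟨p, q, rfl⟩ :=
    exists_eq_of_mem (mem_of_isSMulRegular_quotient_of_smul_mem (hxyz.pow 2) hr₂)
  obtain ⟨s, hs⟩ : x ∣ r₀ * y + r₁ * z + q * z ^ 2 := dvd_of_dvd_mul
    ⟨r₀ * z + r₁ * v * x + (p * x + q * y) * v * y - p * z ^ 2 - r, by linear_combination hr⟩
  have hr₁ : z • (r₁ + q * z) ∈ Ideal.span {x} ⊔ Ideal.span {y} := by
    rw [← Ideal.span_insert, Ideal.mem_span_pair]
    exact ⟨s, -r₀, by rw [smul_eq_mul]; linear_combination -hs⟩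
  obtain ⟨u, t, hut⟩ := exists_eq_of_mem (mem_of_isSMulRegular_quotient_of_smul_mem hxyz hr₁)
  obtain ⟨w, hw⟩ : x ∣ r₀ + z * t := dvd_of_dvd_mul
    ⟨s - z * u, by linear_combination hs + z * hut⟩
  refine mem_hankelIdeal_iff.mpr ⟨w - v * q, u, p + t, hx ?_⟩
  simp only [smul_eq_mul]
  linear_combination hr + (x * z - y ^ 2) * hw - (v * x ^ 2 - y * z) * hut

theorem isSMulRegular_quotient_reesAdjoin_hankel (hx : IsSMulRegular R x)
    (hxy : IsSMulRegular (R ⧸ Ideal.span {x}) y)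
    (hxyz : IsSMulRegular (R ⧸ Ideal.span {x} ⊔ Ideal.span {y}) z) (n : ℕ) :
    IsSMulRegular (R ⧸ reesAdjoin (hankelIdeal x y z v) (hankelCubic x y z v) n) x :=
  isSMulRegular_quotient_reesAdjoin (a := x * z - y ^ 2) (hankelMinors_mem 0) hankelCubic_mem
    hankelIdeal_sq_le hx (isSMulRegular_quotient_span_minor hxy)
    (isSMulRegular_quotient_span_minor_hankelCubic hxy hxyz)
    (isSMulRegular_quotient_hankelIdeal hx hxy hxyz) n

theorem mem_of_isPrime_of_notMem_minimalPrimes [IsLocalRing R] [IsNoetherianRing R] {I : Ideal R}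
    (h : IsLocalRing.maximalIdeal R ∈ (I ⊔ Ideal.span {x}).minimalPrimes) {Q : Ideal R}
    (hQ : Q.IsPrime) (hIQ : I ≤ Q) (hQmin : Q ∉ I.minimalPrimes) : x ∈ Q := by
  obtain ⟨p, hp, hpQ⟩ := Ideal.exists_minimalPrimes_le hIQ
  by_contra hxQ
  have hpQ' : p < Q := hpQ.lt_of_ne fun h => hQmin (h ▸ hp)
  have hQm : Q < IsLocalRing.maximalIdeal R := (IsLocalRing.le_maximalIdeal hQ.ne_top).lt_of_ne
    fun heq => hxQ (heq ▸ h.le (Ideal.mem_sup_right (Ideal.mem_span_singleton_self x)))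
  have hmap {J K : Ideal R} (hIJ : I ≤ J) (hJK : J < K) :
      J.map (Ideal.Quotient.mk I) < K.map (Ideal.Quotient.mk I) := by
    refine (Ideal.map_mono hJK.le).lt_of_ne fun heq => hJK.ne ?_
    rw [← Ideal.comap_map_mk hIJ, heq, Ideal.comap_map_mk (hIJ.trans hJK.le)]
  have hprime {J : Ideal R} (hIJ : I ≤ J) (hJ : J.IsPrime) :
      (J.map (Ideal.Quotient.mk I)).IsPrime :=
    Ideal.map_isPrime_of_surjective Ideal.Quotient.mk_surjective (by rwa [Ideal.mk_ker])
  have := hprime hp.le hp.isPrime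
  have := hprime hIQ hQ
  have := hprime (hIQ.trans hQm.le) (IsLocalRing.maximalIdeal.isMaximal R).isPrime
  have hle := (Ideal.height_add_one_le_of_lt_of_isPrime (hmap hIQ hQm)).trans
    (Ideal.map_height_le_one_of_mem_minimalPrimes h)
  have hle' := (le_add_left le_rfl).trans
    (Ideal.height_add_one_le_of_lt_of_isPrime (hmap hp.le hpQ'))
  have := (add_le_add_left hle' 1).trans hle
  norm_num at this

theorem eq_maximalIdeal_of_hankelIdeal_le [IsLocalRing R]
    (hm : IsLocalRing.maximalIdeal R = Ideal.span (Set.range ![x, y, z])) {Q : Ideal R}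
    (hQ : Q.IsPrime) (hIQ : hankelIdeal x y z v ≤ Q) (hxQ : x ∈ Q) :
    Q = IsLocalRing.maximalIdeal R := by
  have hyQ : y ∈ Q := hQ.mem_of_pow_mem 2 <| by
    have h : y ^ 2 = z * x - (x * z - y ^ 2) := by ring
    rw [h]
    exact sub_mem (Q.mul_mem_left z hxQ) (hIQ (hankelMinors_mem 0))
  have hzQ : z ∈ Q := hQ.mem_of_pow_mem 2 <| by
    have h : z ^ 2 = v * x * y - (v * x * y - z ^ 2) := by ring
    rw [h]
    exact sub_mem (Q.mul_mem_left _ hyQ) (hIQ (hankelMinors_mem 2))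
  refine (IsLocalRing.le_maximalIdeal hQ.ne_top).antisymm ?_
  rw [hm, Ideal.span_le]
  rintro _ ⟨i, rfl⟩
  fin_cases i <;> assumption

theorem symbolicPower_hankelIdeal [IsLocalRing R] [IsNoetherianRing R]
    (hm : IsLocalRing.maximalIdeal R = Ideal.span (Set.range ![x, y, z]))
    (hx : IsSMulRegular R x) (hxy : IsSMulRegular (R ⧸ Ideal.span {x}) y)
    (hxyz : IsSMulRegular (R ⧸ Ideal.span {x} ⊔ Ideal.span {y}) z) (n : ℕ) :
    symbolicPower (hankelIdeal x y z v) n =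
      reesAdjoin (hankelIdeal x y z v) (hankelCubic x y z v) n := by
  have hxmem : x ∈ Ideal.span (Set.range ![x, y, z]) := Ideal.subset_span ⟨0, rfl⟩
  refine symbolicPower_eq_of_isSMulRegular (pow_le_reesAdjoin _ _ n)
    (fun r => exists_pow_mul_mem_pow_of_mem_reesAdjoin (mul_hankelCubic_mem_sq hxmem))
    (isSMulRegular_quotient_hankelIdeal hx hxy hxyz)
    (isSMulRegular_quotient_reesAdjoin_hankel hx hxy hxyz n)
    fun Q hQ hIQ => mem_of_isPrime_of_notMem_minimalPrimes ?_ hQ hIQ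
  refine ⟨⟨(IsLocalRing.maximalIdeal.isMaximal R).isPrime, sup_le ?_ ?_⟩, fun Q hQ _ => ?_⟩
  · rw [hm]
    exact hankelIdeal_le_sq.trans (Ideal.pow_le_self two_ne_zero)
  · rwa [hm, Ideal.span_singleton_le_iff_mem]
  · exact (eq_maximalIdeal_of_hankelIdeal_le hm hQ.1 (le_sup_left.trans hQ.2)
      (hQ.2 (Ideal.mem_sup_right (Ideal.mem_span_singleton_self x)))).ge

theorem aeval_mul_of_isHomogeneous {σ S : Type*} [CommRing S] [Algebra R S]
    {P : MvPolynomial σ R} {n : ℕ} (hP : P.IsHomogeneous n) (t : S) (f : σ → S) :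
    aeval (fun i => t * f i) P = t ^ n * aeval f P := by
  rw [aeval_def, aeval_def, eval₂_eq, eval₂_eq, Finset.mul_sum]
  refine Finset.sum_congr rfl fun α hα => ?_
  have hα : ∑ i ∈ α.support, α i = n := by
    by_contra hne
    exact mem_support_iff.mp hα (hP.coeff_eq_zero hne)
  simp only [mul_pow, Finset.prod_mul_distrib, Finset.prod_pow_eq_pow_sum, hα]
  ring

/-- The minors define a Cremona transformation of the plane: evaluated at the quadratic forms `xd`,
`yd`, `zd` in the minors, they return the minors up to a common factor. -/
theorem eq_zero_of_aeval_hankelMinors_eq_zero [IsDomain R] {v : R}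
    {P : MvPolynomial (Fin 3) R} {n : ℕ} (hP : P.IsHomogeneous n)
    (h : aeval (hankelMinors (X 0) (X 1) (X 2) (C v) : Fin 3 → MvPolynomial (Fin 3) R) P = 0) :
    P = 0 := by
  let inv : Fin 3 → MvPolynomial (Fin 3) R :=
    ![X 1 ^ 2 - X 0 * X 2, X 1 * X 2 + C v * X 0 ^ 2, X 2 ^ 2 + C v * X 0 * X 1]
  let E : MvPolynomial (Fin 3) R :=
    C v * X 1 ^ 3 - 3 * C v * X 0 * X 1 * X 2 - C v ^ 2 * X 0 ^ 3 - X 2 ^ 3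
  have hE : E ≠ 0 := fun h => by simpa [E] using congrArg (eval ![0, 0, 1]) h
  have hinv (i : Fin 3) : aeval inv (hankelMinors (X 0) (X 1) (X 2) (C v) i) = E * X i := by
    rw [← AlgHom.coe_toRingHom, map_hankelMinors]
    fin_cases i <;> simp [hankelMinors, inv, E, algebraMap_eq] <;> ring
  have hzero := congrArg (aeval inv) h
  simp only [comp_aeval_apply, hinv] at hzero
  rw [aeval_mul_of_isHomogeneous hP, aeval_X_left_apply, map_zero] at hzero
  exact (mul_eq_zero.mp hzero).resolve_left (pow_ne_zero n hE)

theorem hankelCubic_mul_mem_pow_add_two [IsLocalRing R]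
    (hm : IsLocalRing.maximalIdeal R = Ideal.span (Set.range ![x, y, z])) {n : ℕ} {r : R}
    (hr : r ∈ IsLocalRing.maximalIdeal R * hankelIdeal x y z v ^ n) :
    hankelCubic x y z v * r ∈ hankelIdeal x y z v ^ (n + 2) := by
  have hle : Ideal.span {hankelCubic x y z v} * (IsLocalRing.maximalIdeal R *
      hankelIdeal x y z v ^ n) ≤ hankelIdeal x y z v ^ (n + 2) := by
    rw [← mul_assoc, mul_comm (Ideal.span _), add_comm, pow_add]
    refine Ideal.mul_mono_left (Ideal.mul_le.mpr fun t ht s hs => ?_)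
    obtain ⟨c, rfl⟩ := Ideal.mem_span_singleton.mp hs
    rw [← mul_assoc]
    exact Ideal.mul_mem_right _ _ (mul_hankelCubic_mem_sq (hm ▸ ht))
  exact hle (Ideal.mul_mem_mul (Ideal.mem_span_singleton_self _) hr)

section LocalRing

variable [IsLocalRing R] [IsNoetherianRing R]

theorem map_residue_eq_zero_of_hankelCubic_pow_mul_eval_mem (hdim : ringKrullDim R = 3)
    (hm : IsLocalRing.maximalIdeal R = Ideal.span (Set.range ![x, y, z]))
    {P : MvPolynomial (Fin 3) R} {n e : ℕ} (hP : P.IsHomogeneous n)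
    (h : hankelCubic x y z v ^ e * eval (hankelMinors x y z v) P ∈
      IsLocalRing.maximalIdeal R ^ (3 * e + 2 * n + 1)) :
    map (IsLocalRing.residue R) P = 0 := by
  let ρ := IsLocalRing.residue R
  let Q : MvPolynomial (Fin 3) R := hankelCubic (X 0) (X 1) (X 2) (C v) ^ e *
    aeval (hankelMinors (X 0) (X 1) (X 2) (C v)) P
  have hQ : Q.IsHomogeneous (3 * e + 2 * n) :=
    ((isHomogeneous_hankelCubic v).pow e).mul (hP.aeval _ (isHomogeneous_hankelMinors v))
  have hQeval : eval ![x, y, z] Q = hankelCubic x y z v ^ e * eval (hankelMinors x y z v) P := by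
    have hC : (eval ![x, y, z]).comp (algebraMap R (MvPolynomial (Fin 3) R)) = RingHom.id R :=
      RingHom.ext eval_C
    rw [map_mul, map_pow, eval_hankelCubic, map_aeval, hC]
    simp only [eval_hankelMinors]
    rfl
  have hQmap : map ρ Q = hankelCubic (X 0) (X 1) (X 2) (C (ρ v)) ^ e *
      aeval (hankelMinors (X 0) (X 1) (X 2) (C (ρ v))) (map ρ P) := by
    have hC : (MvPolynomial.map ρ).comp (algebraMap R (MvPolynomial (Fin 3) R)) =
        (algebraMap _ _).comp ρ :=
      RingHom.ext (map_C ρ)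
    rw [map_mul, map_pow, map_hankelCubic, map_aeval, hC, aeval_def, eval₂_map]
    simp only [map_hankelMinors, map_X, map_C]
    rfl
  have hcubic : (hankelCubic (X 0) (X 1) (X 2) (C (ρ v)) :
      MvPolynomial (Fin 3) (IsLocalRing.ResidueField R)) ≠ 0 := fun h => by
    simpa [hankelCubic] using congrArg (eval ![0, 0, 1]) h
  have hzero := map_residue_eq_zero_of_eval_mem_pow hdim hm hQ (hQeval ▸ h)
  rw [hQmap] at hzero
  exact eq_zero_of_aeval_hankelMinors_eq_zero (hP.map ρ)
    ((mul_eq_zero.mp hzero).resolve_left (pow_ne_zero e hcubic))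

theorem mem_mul_pow_of_hankelCubic_pow_mul_mem (hdim : ringKrullDim R = 3)
    (hm : IsLocalRing.maximalIdeal R = Ideal.span (Set.range ![x, y, z])) {n e : ℕ} {r : R}
    (hr : r ∈ hankelIdeal x y z v ^ n)
    (h : hankelCubic x y z v ^ e * r ∈ IsLocalRing.maximalIdeal R ^ (3 * e + 2 * n + 1)) :
    r ∈ IsLocalRing.maximalIdeal R * hankelIdeal x y z v ^ n := by
  obtain ⟨P, hP, rfl⟩ := (Ideal.mem_span_pow_iff_exists_isHomogeneous _ _).mp hr
  refine eval_mem_mul_span_range_pow hP fun α => ?_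
  rw [← IsLocalRing.residue_eq_zero_iff, ← coeff_map,
    map_residue_eq_zero_of_hankelCubic_pow_mul_eval_mem hdim hm hP h, coeff_zero]

theorem mem_mul_pow_of_mem_reesAdjoin (hdim : ringKrullDim R = 3)
    (hm : IsLocalRing.maximalIdeal R = Ideal.span (Set.range ![x, y, z])) {n e : ℕ} {r : R}
    (hr : r ∈ reesAdjoin (hankelIdeal x y z v) (hankelCubic x y z v) n)
    (h : hankelCubic x y z v ^ e * r ∈ IsLocalRing.maximalIdeal R ^ (3 * e + 2 * n + 1)) :
    r ∈ IsLocalRing.maximalIdeal R * hankelIdeal x y z v ^ n := by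
  induction n using Nat.twoStepInduction generalizing e r with
  | zero => exact mem_mul_pow_of_hankelCubic_pow_mul_mem hdim hm (by simp) h
  | one => exact mem_mul_pow_of_hankelCubic_pow_mul_mem hdim hm (by rwa [pow_one]) h
  | more n ih _ =>
    obtain ⟨u, hu, t, ht, rfl⟩ := mem_reesAdjoin_add_two.mp hr
    have hdu : hankelCubic x y z v ^ e * u ∈
        IsLocalRing.maximalIdeal R ^ (3 * e + 2 * (n + 2)) := by
      rw [hm, pow_add, pow_mul, pow_mul]
      exact Ideal.mul_mem_mul (Ideal.pow_mem_pow hankelCubic_mem_pow_three e)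
        (Ideal.pow_right_mono hankelIdeal_le_sq _ hu)
    have hdt : hankelCubic x y z v ^ (e + 1) * t ∈
        IsLocalRing.maximalIdeal R ^ (3 * (e + 1) + 2 * n + 1) := by
      have := sub_mem (Ideal.pow_le_pow_right (Nat.le_succ _) h) hdu
      rw [show 3 * (e + 1) + 2 * n + 1 = 3 * e + 2 * (n + 2) by ring]
      convert this using 1
      ring
    exact mem_mul_pow_of_hankelCubic_pow_mul_mem hdim hm
      (add_mem hu (hankelCubic_mul_mem_pow_add_two hm (ih ht hdt))) h

theorem length_hankelIdeal_pow_quotient (hdim : ringKrullDim R = 3)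
    (hm : IsLocalRing.maximalIdeal R = Ideal.span (Set.range ![x, y, z])) (n : ℕ) :
    Module.length R (↥(hankelIdeal x y z v ^ n) ⧸
      (IsLocalRing.maximalIdeal R * hankelIdeal x y z v ^ n).submoduleOf
        (hankelIdeal x y z v ^ n)) = ((n + 2).choose 2 : ℕ) := by
  have hlength := length_span_range_pow_quotient (g := hankelMinors x y z v) (n := n)
    fun P hP h => map_residue_eq_zero_of_hankelCubic_pow_mul_eval_mem (e := 0) hdim hm hP <| by
      rw [pow_zero, one_mul, mul_zero, zero_add, pow_succ', pow_mul, hm]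
      exact Ideal.mul_mono (hm.le) (Ideal.pow_right_mono hankelIdeal_le_sq n) h
  rw [Fintype.card_fin, Nat.multichoose_eq, show 3 + n - 1 = n + 2 by omega,
    Nat.choose_symm_add] at hlength
  exact hlength

theorem length_reesAdjoin_quotient_add_two (hdim : ringKrullDim R = 3)
    (hm : IsLocalRing.maximalIdeal R = Ideal.span (Set.range ![x, y, z])) (n : ℕ) :
    Module.length R (reesAdjoin (hankelIdeal x y z v) (hankelCubic x y z v) (n + 2) ⧸
        (hankelIdeal x y z v ^ (n + 2)).submoduleOf
          (reesAdjoin (hankelIdeal x y z v) (hankelCubic x y z v) (n + 2))) =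
      ((n + 2).choose 2 : ℕ) +
        Module.length R (reesAdjoin (hankelIdeal x y z v) (hankelCubic x y z v) n ⧸
          (hankelIdeal x y z v ^ n).submoduleOf
            (reesAdjoin (hankelIdeal x y z v) (hankelCubic x y z v) n)) := by
  set I := hankelIdeal x y z v
  set d := hankelCubic x y z v
  let f : reesAdjoin I d n →ₗ[R] reesAdjoin I d (n + 2) ⧸ (I ^ (n + 2)).submoduleOf _ :=
    Submodule.mkQ _ ∘ₗ (LinearMap.mulLeft R d).restrict fun _ => mul_mem_reesAdjoin_add_two
  have hf : Function.Surjective f := fun q => by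
    obtain ⟨⟨r, hr⟩, rfl⟩ := Submodule.Quotient.mk_surjective _ q
    obtain ⟨u, hu, t, ht, rfl⟩ := mem_reesAdjoin_add_two.mp hr
    refine ⟨⟨t, ht⟩, (Submodule.Quotient.eq _).mpr ?_⟩
    change d * t - (u + d * t) ∈ I ^ (n + 2)
    rw [sub_add_cancel_right]
    exact neg_mem hu
  have hker : LinearMap.ker f =
      (IsLocalRing.maximalIdeal R * I ^ n).submoduleOf (reesAdjoin I d n) := by
    ext ⟨r, hr⟩
    refine (LinearMap.mem_ker.trans (Submodule.Quotient.mk_eq_zero _)).trans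
      ⟨fun h => ?_, fun h => hankelCubic_mul_mem_pow_add_two hm h⟩
    refine mem_mul_pow_of_mem_reesAdjoin (e := 1) hdim hm hr ?_
    rw [pow_one, show 3 * 1 + 2 * n + 1 = 2 * (n + 2) by ring, pow_mul, hm]
    exact Ideal.pow_right_mono hankelIdeal_le_sq _ h
  rw [← length_quotient_eq_of_surjective f hf hker, ← length_hankelIdeal_pow_quotient hdim hm n]
  exact length_quotient_submoduleOf_add Ideal.mul_le_right (pow_le_reesAdjoin I d n)

theorem isSMulRegular_of_maximalIdeal_eq_span (hdim : ringKrullDim R = 3)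
    (hm : IsLocalRing.maximalIdeal R = Ideal.span (Set.range ![x, y, z])) :
    IsSMulRegular R x ∧ IsSMulRegular (R ⧸ Ideal.span {x}) y ∧
      IsSMulRegular (R ⧸ Ideal.span {x} ⊔ Ideal.span {y}) z := by
  have hs := isPermutablyRegular_of_maximalIdeal_eq_span (s := ![x, y, z]) hdim hm
  have hx := hs ∅ 0 (by simp)
  have hxy := hs {0} 1 (by simp)
  have hxyz := hs {0, 1} 2 (by simp)
  rw [Set.image_empty, Ideal.span_empty] at hx
  rw [Set.image_singleton] at hxy
  rw [Set.image_pair, Ideal.span_insert] at hxyz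
  exact ⟨(LinearEquiv.isSMulRegular_congr (Submodule.quotEquivOfEqBot ⊥ rfl) x).mp hx, hxy, hxyz⟩

theorem symbolicQuotientLength_hankelIdeal (hdim : ringKrullDim R = 3)
    (hm : IsLocalRing.maximalIdeal R = Ideal.span (Set.range ![x, y, z])) (n : ℕ) :
    symbolicQuotientLength (hankelIdeal x y z v) n =
      ((∑ k ∈ Finset.Icc 1 (n / 2), (n - 2 * k + 2).choose 2 : ℕ) : ℕ∞) := by
  obtain ⟨hx, hxy, hxyz⟩ := isSMulRegular_of_maximalIdeal_eq_span hdim hm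
  rw [symbolicQuotientLength, symbolicPower_hankelIdeal hm hx hxy hxyz]
  induction n using Nat.twoStepInduction with
  | zero =>
    rw [Finset.sum_eq_zero (by simp), Nat.cast_zero, Module.length_eq_zero_iff,
      Submodule.Quotient.subsingleton_iff, Submodule.submoduleOf_eq_top, pow_zero, Ideal.one_eq_top]
    exact le_top
  | one =>
    rw [Finset.sum_eq_zero (by simp), Nat.cast_zero, Module.length_eq_zero_iff,
      Submodule.Quotient.subsingleton_iff, Submodule.submoduleOf_eq_top]
    exact (pow_one (hankelIdeal x y z v)).ge
  | more n ih _ =>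
    rw [length_reesAdjoin_quotient_add_two hdim hm, ih, sum_choose_add_two, Nat.cast_add]

end LocalRing

end Hankel

theorem maximalMinorsIdeal_eq_span {R : Type*} [CommRing R] (M : Matrix (Fin 2) (Fin 3) R) :
    maximalMinorsIdeal M = Ideal.span (Set.range
      ![M 0 0 * M 1 1 - M 0 1 * M 1 0, M 0 0 * M 1 2 - M 0 2 * M 1 0,
        M 0 1 * M 1 2 - M 0 2 * M 1 1]) := by
  rw [maximalMinorsIdeal]
  congr 1
  refine Set.Subset.antisymm ?_ ?_
  · rintro _ ⟨e, rfl⟩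
    have he : e 0 < e 1 := e.strictMono (by decide)
    simp only [Matrix.det_fin_two, Matrix.submatrix_apply, id]
    generalize e 0 = i at he ⊢
    generalize e 1 = j at he ⊢
    fin_cases i <;> fin_cases j <;> first | exact absurd he (by decide) | simp
  · have exists_columns {i j : Fin 3} (hij : i < j) :
        ∃ e : Fin 2 ↪o Fin 3, (M.submatrix id e).det = M 0 i * M 1 j - M 0 j * M 1 i :=
      ⟨OrderEmbedding.ofStrictMono ![i, j] (by simpa [Fin.strictMono_iff_lt_succ] using hij),
        Matrix.det_fin_two _⟩
    rintro _ ⟨k, rfl⟩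
    fin_cases k
    exacts [exists_columns (by decide), exists_columns (by decide), exists_columns (by decide)]

theorem maximalMinorsIdeal_eq_hankelIdeal {R : Type*} [CommRing R] (x y z v : R) :
    maximalMinorsIdeal !![x, y, z; y, z, v * x] = hankelIdeal x y z v := by
  rw [maximalMinorsIdeal_eq_span, hankelIdeal, hankelMinors]
  simp only [Matrix.of_apply, Matrix.cons_val]
  ring_nf

theorem theorem5p10_general {R : Type*} [CommRing R] [IsLocalRing R] [IsNoetherianRing R]
    (hdim : ringKrullDim R = 3) (x y z v : R)
    (hm : IsLocalRing.maximalIdeal R = Ideal.span {x, y, z})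
    (I : Ideal R)
    (hI : I = maximalMinorsIdeal !![x, y, z; y, z, v * x]) :
    (∀ n : ℕ,
      symbolicQuotientLength I n
          = ((∑ k ∈ Finset.Icc 1 (n / 2), (n - 2 * k + 2).choose 2 : ℕ) : ℕ∞) ∧
      (Even n →
        ((symbolicQuotientLength I n).toNat : ℚ)
          = 1 / 2 * ((n + 2).choose 3 : ℚ) - 1 / 4 * ((n + 1).choose 2 : ℚ)
              - 1 / 8 * (n : ℚ)) ∧
      (Odd n →
        ((symbolicQuotientLength I n).toNat : ℚ)
          = 1 / 2 * ((n + 2).choose 3 : ℚ) - 1 / 4 * ((n + 1).choose 2 : ℚ)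
              - 1 / 8 * (n : ℚ) - 1 / 8)) ∧
    HasEpsilonMultiplicity I (1 / 2) := by
  have hrange : Set.range ![x, y, z] = {x, y, z} := by
    simp only [Matrix.range_cons, Matrix.range_empty, Set.union_empty, Set.singleton_union]
  rw [maximalMinorsIdeal_eq_hankelIdeal] at hI
  subst hI
  have hlen := symbolicQuotientLength_hankelIdeal (v := v) hdim (hrange ▸ hm)
  refine ⟨fun n => ⟨hlen n, fun hn => ?_, fun hn => ?_⟩, fun n _ => ?_, ?_⟩
  · rw [hlen, ENat.toNat_natCast, cast_sum_choose, if_neg (Nat.not_odd_iff_even.mpr hn), sub_zero]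
  · rw [hlen, ENat.toNat_natCast, cast_sum_choose, if_pos hn]
  · rw [hlen]
    exact ENat.natCast_ne_top _
  · simp only [hlen, ENat.toNat_natCast]
    exact tendsto_sum_choose

theorem theorem5p10 {R : Type*} [CommRing R] [IsRegularLocalRing R]
    (hdim : ringKrullDim R = 3) (x y z : R)
    (hm : IsLocalRing.maximalIdeal R = Ideal.span {x, y, z})
    (I : Ideal R)
    (hI : I = maximalMinorsIdeal !![x, y, z; y, z, x ^ 2]) :
    (∀ n : ℕ, 1 ≤ n →
      symbolicQuotientLength I n
          = ((∑ k ∈ Finset.Icc 1 (n / 2), (n - 2 * k + 2).choose 2 : ℕ) : ℕ∞) ∧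
      (Even n →
        ((symbolicQuotientLength I n).toNat : ℚ)
          = 1 / 2 * ((n + 2).choose 3 : ℚ) - 1 / 4 * ((n + 1).choose 2 : ℚ)
              - 1 / 8 * (n : ℚ)) ∧
      (Odd n →
        ((symbolicQuotientLength I n).toNat : ℚ)
          = 1 / 2 * ((n + 2).choose 3 : ℚ) - 1 / 4 * ((n + 1).choose 2 : ℚ)
              - 1 / 8 * (n : ℚ) - 1 / 8)) ∧
    HasEpsilonMultiplicity I (1 / 2) := by
  obtain ⟨hlen, hlim⟩ := theorem5p10_general hdim x y z x hm I (pow_two x ▸ hI)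
  exact ⟨fun n _ => hlen n, hlim⟩
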